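/- **Theorem 2.** Let $e_1,e_2,e_3,e_4$ be the standard orthonormal basis of the Euclidean space $V=\mathbb{R}^4$ and let $\Phi=F_4\subset V$ be the root system consisting of the 48 vectors $\pm e_i$, $\pm e_i\pm e_j$ $(i\neq j)$ and $(\pm e_1\pm e_2\pm e_3\pm e_4)/2$, with fundamental roots $a=e_2-e_3$, $b=e_3-e_4$, $c=e_4$, $d=(e_1-e_2-e_3-e_4)/2$. For $x,y\in V$ write $x\prec y$ if the first nonzero coefficient of $y-x$ with respect to the basis $a,b,c,d$ is positive. Writing $\alpha\beta\gamma\delta$ for $\alpha a+\beta b+\gamma c+\delta d$, the positive roots in increasing order are $$r_{1}=0001,\ r_{2}=0010,\ r_{3}=0011,\ r_{4}=0100,\ r_{5}=0110,\ r_{6}=0111,\ r_{7}=0120,\ r_{8}=0121,\ r_{9}=0122,\ r_{10}=1000,\ r_{11}=1100,\ r_{12}=1110,\ r_{13}=1111,\ r_{14}=1120,\ r_{15}=1121,\ r_{16}=1122,\ r_{17}=1220,\ r_{18}=1221,\ r_{19}=1222,\ r_{20}=1231,\ r_{21}=1232,\ r_{22}=1242,\ r_{23}=1342,\ r_{24}=2342.$$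 A pair of roots $(r,s)$ is special if $r+s\in\Phi$ and $0\prec r\prec s$; it is extraspecial if moreover $r\preceq r'$ for every special pair $(r',s')$ with $r'+s'=r+s$. Let $L$ be a complex simple Lie algebra of type $F_4$ whose roots with respect to a Cartan subalgebra are identified with $\Phi$, and let $x_r$ $(r\in\Phi)$ be the root vectors of a Chevalley basis of $L$: $[x_r,x_{-r}]=h_r$ is the coroot of $r$, and $[x_r,x_s]=N_{r,s}x_{r+s}$ with $N_{r,s}=\pm(p+1)$ whenever $r,s,r+s\in\Phi$, where $p$ is the greatest integer such that $s-pr\in\Phi$. Put $N_{r,s}=0$ if $r+s\notin\Phi$. Suppose that $N_{r,s}>0$ for all extraspecial pairs $(r,s)$. Then all structure constants are determined as follows. (1) For positive roots, $N_{r_i,r_j}$ is the entry in row $i$ and column $j$ of the following table (a dot stands for $0$; all constants $N_{r_i,r_j}$ with $i=24$ or $j=24$ are $0$). $$ \scriptsize \begin{array}{r|rrrrrrrrrrrrrrrrrrrrrrr} & 1 & 2 & 3 & 4 & 5 & 6 & 7 & 8 & 9 & 10 & 11 & 12 & 13 & 14 & 15 & 16 & 17 & 18 & 19 & 20 & 21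 & 22 & 23 \\ \hline 1 & \cdot & 1 & \cdot & \cdot & 1 & \cdot & 1 & 2 & \cdot & \cdot & \cdot & 1 & \cdot & 1 & 2 & \cdot & 1 & 2 & \cdot & 1 & \cdot & \cdot & \cdot \\ 2 & -1 & \cdot & \cdot & 1 & 2 & 1 & \cdot & \cdot & \cdot & \cdot & 1 & 2 & 1 & \cdot & \cdot & \cdot & \cdot & 1 & 1 & \cdot & 2 & \cdot & \cdot \\ 3 & \cdot & \cdot & \cdot & 1 & 1 & 2 & \cdot & \cdot & \cdot & \cdot & 1 & 1 & 2 & \cdot & \cdot & \cdot & -1 & -1 & \cdot & -2 & \cdot & \cdot & \cdot \\ 4 & \cdot & -1 & -1 & \cdot & \cdot & \cdot & \cdot & \cdot & \cdot & 1 & \cdot & \cdot & \cdot & 1 & 1 & 1 & \cdot & \cdot & \cdot & \cdot & \cdot & 1 & \cdot \\ 5 & -1 & -2 & -1 & \cdot & \cdot & \cdot & \cdot & \cdot & \cdot & 1 & \cdot & -2 & -1 & \cdot & 1 & 1 & \cdot & \cdot & \cdot & \cdot & -2 & \cdot & \cdot \\ 6 & \cdot & -1 & -2 & \cdot & \cdot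 & \cdot & \cdot & \cdot & \cdot & 1 & \cdot & -1 & -2 & -1 & -1 & \cdot & \cdot & \cdot & \cdot & 2 & \cdot & \cdot & \cdot \\ 7 & -1 & \cdot & \cdot & \cdot & \cdot & \cdot & \cdot & \cdot & \cdot & 1 & 1 & \cdot & -1 & \cdot & \cdot & 1 & \cdot & \cdot & 1 & \cdot & \cdot & \cdot & \cdot \\ 8 & -2 & \cdot & \cdot & \cdot & \cdot & \cdot & \cdot & \cdot & \cdot & 1 & 1 & 1 & -1 & \cdot & -2 & \cdot & \cdot & -2 & \cdot & \cdot & \cdot & \cdot & \cdot \\ 9 & \cdot & \cdot & \cdot & \cdot & \cdot & \cdot & \cdot & \cdot & \cdot & 1 & 1 & 1 & \cdot & 1 & \cdot & \cdot & 1 & \cdot & \cdot & \cdot & \cdot & \cdot & \cdot \\ 10 & \cdot & \cdot & \cdot & -1 & -1 & -1 & -1 & -1 & -1 & \cdot & \cdot & \cdot & \cdot & \cdot & \cdot & \cdot & \cdot & \cdot & \cdot & \cdot & \cdot & \cdot & 1 \\ 11 & \cdot & -1 & -1 & \cdot & \cdot & \cdot & -1 & -1 & -1 & \cdot & \cdot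 & \cdot & \cdot & \cdot & \cdot & \cdot & \cdot & \cdot & \cdot & \cdot & \cdot & -1 & \cdot \\ 12 & -1 & -2 & -1 & \cdot & 2 & 1 & \cdot & -1 & -1 & \cdot & \cdot & \cdot & \cdot & \cdot & \cdot & \cdot & \cdot & \cdot & \cdot & \cdot & 2 & \cdot & \cdot \\ 13 & \cdot & -1 & -2 & \cdot & 1 & 2 & 1 & 1 & \cdot & \cdot & \cdot & \cdot & \cdot & \cdot & \cdot & \cdot & \cdot & \cdot & \cdot & -2 & \cdot & \cdot & \cdot \\ 14 & -1 & \cdot & \cdot & -1 & \cdot & 1 & \cdot & \cdot & -1 & \cdot & \cdot & \cdot & \cdot & \cdot & \cdot & \cdot & \cdot & \cdot & -1 & \cdot & \cdot & \cdot & \cdot \\ 15 & -2 & \cdot & \cdot & -1 & -1 & 1 & \cdot & 2 & \cdot & \cdot & \cdot & \cdot & \cdot & \cdot & \cdot & \cdot & \cdot & 2 & \cdot & \cdot & \cdot & \cdot & \cdot \\ 16 & \cdot & \cdot & \cdot & -1 & -1 & \cdot & -1 & \cdot & \cdot & \cdot & \cdot & \cdot & \cdot & \cdot & \cdot & \cdot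 & -1 & \cdot & \cdot & \cdot & \cdot & \cdot & \cdot \\ 17 & -1 & \cdot & 1 & \cdot & \cdot & \cdot & \cdot & \cdot & -1 & \cdot & \cdot & \cdot & \cdot & \cdot & \cdot & 1 & \cdot & \cdot & \cdot & \cdot & \cdot & \cdot & \cdot \\ 18 & -2 & -1 & 1 & \cdot & \cdot & \cdot & \cdot & 2 & \cdot & \cdot & \cdot & \cdot & \cdot & \cdot & -2 & \cdot & \cdot & \cdot & \cdot & \cdot & \cdot & \cdot & \cdot \\ 19 & \cdot & -1 & \cdot & \cdot & \cdot & \cdot & -1 & \cdot & \cdot & \cdot & \cdot & \cdot & \cdot & 1 & \cdot & \cdot & \cdot & \cdot & \cdot & \cdot & \cdot & \cdot & \cdot \\ 20 & -1 & \cdot & 2 & \cdot & \cdot & -2 & \cdot & \cdot & \cdot & \cdot & \cdot & \cdot & 2 & \cdot & \cdot & \cdot & \cdot & \cdot & \cdot & \cdot & \cdot & \cdot & \cdot \\ 21 & \cdot & -2 & \cdot & \cdot & 2 & \cdot & \cdot & \cdot & \cdot & \cdot & \cdot & -2 & \cdot & \cdot & \cdot & \cdot & \cdot & \cdot & \cdot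 & \cdot & \cdot & \cdot & \cdot \\ 22 & \cdot & \cdot & \cdot & -1 & \cdot & \cdot & \cdot & \cdot & \cdot & \cdot & 1 & \cdot & \cdot & \cdot & \cdot & \cdot & \cdot & \cdot & \cdot & \cdot & \cdot & \cdot & \cdot \\ 23 & \cdot & \cdot & \cdot & \cdot & \cdot & \cdot & \cdot & \cdot & \cdot & -1 & \cdot & \cdot & \cdot & \cdot & \cdot & \cdot & \cdot & \cdot & \cdot & \cdot & \cdot & \cdot & \cdot \\ \end{array} $$ (2) For $1\le i<j\le 24$, $N_{r_i,-r_j}$ is the entry in row $i$ and column $-j$ of the following table (a dot stands for $0$). $$ \scriptsize \begin{array}{r|rrrrrrrrrrrrrrrrrrrrrrrr} & -1 & -2 & -3 & -4 & -5 & -6 & -7 & -8 & -9 & -10 & -11 & -12 & -13 & -14 & -15 & -16 & -17 & -18 & -19 & -20 & -21 & -22 & -23 & -24 \\ \hline 1 & & \cdot & -1 & \cdot & \cdot & -1 & \cdot & -2 & -1 & \cdot & \cdot & \cdot & -1 & \cdot & -2 & -1 & \cdot & -2 & -1 & \cdot & -1 & \cdot & \cdot & \cdot \\ 2 & & & 1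 & \cdot & -2 & \cdot & -1 & -1 & \cdot & \cdot & \cdot & -2 & \cdot & -1 & -1 & \cdot & \cdot & \cdot & \cdot & -1 & -2 & -1 & \cdot & \cdot \\ 3 & & & & \cdot & \cdot & -2 & \cdot & -1 & -1 & \cdot & \cdot & \cdot & -2 & \cdot & -1 & -1 & \cdot & \cdot & \cdot & 2 & 1 & 1 & \cdot & \cdot \\ 4 & & & & & 1 & 1 & \cdot & \cdot & \cdot & \cdot & -1 & \cdot & \cdot & \cdot & \cdot & \cdot & -1 & -1 & -1 & \cdot & \cdot & \cdot & -1 & \cdot \\ 5 & & & & & & 1 & 1 & 1 & \cdot & \cdot & \cdot & -2 & \cdot & \cdot & \cdot & \cdot & 1 & 1 & \cdot & -1 & -2 & \cdot & 1 & \cdot \\ 6 & & & & & & & \cdot & 1 & 1 & \cdot & \cdot & \cdot & -2 & \cdot & \cdot & \cdot & \cdot & 1 & 1 & 2 & 1 & \cdot & -1 & \cdot \\ 7 & & & & & & & & 1 & \cdot & \cdot & \cdot & \cdot & \cdot & -1 & \cdot & \cdot & -1 & \cdot & \cdot & 1 & \cdot & -1 & -1 & \cdot \\ 8 & & & & & &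 & & & 1 & \cdot & \cdot & \cdot & \cdot & \cdot & -2 & \cdot & \cdot & -2 & \cdot & -1 & 1 & 1 & 1 & \cdot \\ 9 & & & & & & & & & & \cdot & \cdot & \cdot & \cdot & \cdot & \cdot & -1 & \cdot & \cdot & -1 & \cdot & -1 & -1 & -1 & \cdot \\ 10 & & & & & & & & & & & 1 & 1 & 1 & 1 & 1 & 1 & \cdot & \cdot & \cdot & \cdot & \cdot & \cdot & \cdot & -1 \\ 11 & & & & & & & & & & & & 1 & 1 & \cdot & \cdot & \cdot & 1 & 1 & 1 & \cdot & \cdot & \cdot & \cdot & 1 \\ 12 & & & & & & & & & & & & & 1 & 1 & 1 & \cdot & -1 & -1 & \cdot & 1 & 2 & \cdot & \cdot & -1 \\ 13 & & & & & & & & & & & & & & \cdot & 1 & 1 & \cdot & -1 & -1 & -2 & -1 & \cdot & \cdot & 1 \\ 14 & & & & & & & & & & & & & & & 1 & \cdot & 1 & \cdot & \cdot & -1 & \cdot & 1 & \cdot & 1 \\ 15 & & & & & & & & & & & & & & & & 1 & \cdot & 2 & \cdot & 1 & -1 & -1 & \cdot & -1 \\ 16 & & & & & & & & & & & & & & & &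 & \cdot & \cdot & 1 & \cdot & 1 & 1 & \cdot & 1 \\ 17 & & & & & & & & & & & & & & & & & & 1 & \cdot & -1 & \cdot & \cdot & 1 & -1 \\ 18 & & & & & & & & & & & & & & & & & & & 1 & 1 & -1 & \cdot & -1 & 1 \\ 19 & & & & & & & & & & & & & & & & & & & & \cdot & 1 & \cdot & 1 & -1 \\ 20 & & & & & & & & & & & & & & & & & & & & & 1 & -1 & 1 & -1 \\ 21 & & & & & & & & & & & & & & & & & & & & & & 1 & -1 & 1 \\ 22 & & & & & & & & & & & & & & & & & & & & & & & 1 & -1 \\ 23 & & & & & & & & & & & & & & & & & & & & & & & & 1 \\ \end{array} $$ (3) The remaining constants follow from $N_{s,r}=-N_{r,s}$ and $N_{-r,-s}=-N_{r,s}$, which hold for all $r,s\in\Phi$. -/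

import Mathlib

namespace F4

/-- The Euclidean space `ℝ⁴`. -/
abbrev V : Type := EuclideanSpace ℝ (Fin 4)

/-- The standard orthonormal basis `e₁, e₂, e₃, e₄`, indexed by `0, 1, 2, 3`. -/
noncomputable def e (i : Fin 4) : V := EuclideanSpace.single i 1

/-- The root system `F₄`: the vectors `± eᵢ`, `± eᵢ ± eⱼ` with `i ≠ j`, and
`(± e₁ ± e₂ ± e₃ ± e₄) / 2`. -/
def Φ : Set V :=
  {v | ∃ i, v = e i ∨ v = -e i} ∪
  {v | ∃ i j, i ≠ j ∧ (v = e i + e j ∨ v = e i - e j ∨ v = -e i - e j)} ∪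
  {v | ∃ σ : Fin 4 → ℝ, (∀ i, σ i = 1 ∨ σ i = -1) ∧ v = (1 / 2 : ℝ) • ∑ i, σ i • e i}

/-- The fundamental roots `a = e₂ - e₃`, `b = e₃ - e₄`, `c = e₄`,
`d = (e₁ - e₂ - e₃ - e₄) / 2`, in this order. -/
noncomputable def fundamental : Fin 4 → V :=
  ![e 1 - e 2, e 2 - e 3, e 3, (1 / 2 : ℝ) • (e 0 - e 1 - e 2 - e 3)]

/-- The vector `t₀ a + t₁ b + t₂ c + t₃ d`. -/
noncomputable def ofCoeffs (t : Fin 4 → ℝ) : V := ∑ i, t i • fundamental i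

/-- The order `x ≺ y` on `V`: the first nonzero coefficient of `y - x` with respect to
`a, b, c, d` is positive. -/
def Prec (x y : V) : Prop :=
  ∃ t : Fin 4 → ℝ, y - x = ofCoeffs t ∧ ∃ i, 0 < t i ∧ ∀ j < i, t j = 0

/-- An ordered pair of roots `(r, s)` is special if `r + s` is a root and `0 ≺ r ≺ s`. -/
def IsSpecial (r s : Φ) : Prop :=
  (r : V) + s ∈ Φ ∧ Prec 0 r ∧ Prec r s

/-- A special pair `(r, s)` is extraspecial if `r ≼ r'` for all special pairs `(r', s')` with
`r' + s' = r + s`. -/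
def IsExtraspecial (r s : Φ) : Prop :=
  IsSpecial r s ∧
    ∀ r' s' : Φ, IsSpecial r' s' → (r' : V) + s' = r + s → r = r' ∨ Prec r r'

theorem neg_mem {v : V} (hv : v ∈ Φ) : -v ∈ Φ := by
  rcases hv with (⟨i, h | h⟩ | ⟨i, j, hij, h | h | h⟩) | ⟨σ, hσ, h⟩
  · exact Or.inl (Or.inl ⟨i, Or.inr (by rw [h])⟩)
  · exact Or.inl (Or.inl ⟨i, Or.inl (by rw [h, neg_neg])⟩)
  · exact Or.inl (Or.inr ⟨i, j, hij, Or.inr (Or.inr (by rw [h]; abel))⟩)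
  · exact Or.inl (Or.inr ⟨j, i, hij.symm, Or.inr (Or.inl (by rw [h]; abel))⟩)
  · exact Or.inl (Or.inr ⟨i, j, hij, Or.inl (by rw [h]; abel)⟩)
  · refine Or.inr ⟨fun i => -σ i, fun i => ?_, ?_⟩
    · rcases hσ i with h | h <;> simp [h]
    · simp [h]

instance : Neg Φ := ⟨fun r => ⟨-(r : V), neg_mem r.2⟩⟩

/-- The coefficients `αβγδ` of the positive roots `α a + β b + γ c + δ d`, numbered `1, …, 24`
in increasing order with respect to `≺` (the root with number `n` has index `n - 1`). -/
def coeffs : Fin 24 → Fin 4 → ℤ :=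
  ![![0, 0, 0, 1], ![0, 0, 1, 0], ![0, 0, 1, 1], ![0, 1, 0, 0], ![0, 1, 1, 0], ![0, 1, 1, 1],
    ![0, 1, 2, 0], ![0, 1, 2, 1], ![0, 1, 2, 2], ![1, 0, 0, 0], ![1, 1, 0, 0], ![1, 1, 1, 0],
    ![1, 1, 1, 1], ![1, 1, 2, 0], ![1, 1, 2, 1], ![1, 1, 2, 2], ![1, 2, 2, 0], ![1, 2, 2, 1],
    ![1, 2, 2, 2], ![1, 2, 3, 1], ![1, 2, 3, 2], ![1, 2, 4, 2], ![1, 3, 4, 2], ![2, 3, 4, 2]]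

theorem ofCoeffs_mem (i : Fin 24) : ofCoeffs (fun k => (coeffs i k : ℝ)) ∈ Φ := by
  fin_cases i
  refine Or.inr ⟨![1, -1, -1, -1], by simp [Fin.forall_fin_succ], ?_⟩
  rotate_left; refine Or.inl (Or.inl ⟨3, Or.inl ?_⟩)
  rotate_left; refine Or.inr ⟨![1, -1, -1, 1], by simp [Fin.forall_fin_succ], ?_⟩
  rotate_left; refine Or.inl (Or.inr ⟨2, 3, by decide, Or.inr (Or.inl ?_)⟩)
  rotate_left; refine Or.inl (Or.inl ⟨2, Or.inl ?_⟩)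
  rotate_left; refine Or.inr ⟨![1, -1, 1, -1], by simp [Fin.forall_fin_succ], ?_⟩
  rotate_left; refine Or.inl (Or.inr ⟨2, 3, by decide, Or.inl ?_⟩)
  rotate_left; refine Or.inr ⟨![1, -1, 1, 1], by simp [Fin.forall_fin_succ], ?_⟩
  rotate_left; refine Or.inl (Or.inr ⟨0, 1, by decide, Or.inr (Or.inl ?_)⟩)
  rotate_left; refine Or.inl (Or.inr ⟨1, 2, by decide, Or.inr (Or.inl ?_)⟩)
  rotate_left; refine Or.inl (Or.inr ⟨1, 3, by decide, Or.inr (Or.inl ?_)⟩)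
  rotate_left; refine Or.inl (Or.inl ⟨1, Or.inl ?_⟩)
  rotate_left; refine Or.inr ⟨![1, 1, -1, -1], by simp [Fin.forall_fin_succ], ?_⟩
  rotate_left; refine Or.inl (Or.inr ⟨1, 3, by decide, Or.inl ?_⟩)
  rotate_left; refine Or.inr ⟨![1, 1, -1, 1], by simp [Fin.forall_fin_succ], ?_⟩
  rotate_left; refine Or.inl (Or.inr ⟨0, 2, by decide, Or.inr (Or.inl ?_)⟩)
  rotate_left; refine Or.inl (Or.inr ⟨1, 2, by decide, Or.inl ?_⟩)
  rotate_left; refine Or.inr ⟨![1, 1, 1, -1], by simp [Fin.forall_fin_succ], ?_⟩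
  rotate_left; refine Or.inl (Or.inr ⟨0, 3, by decide, Or.inr (Or.inl ?_)⟩)
  rotate_left; refine Or.inr ⟨![1, 1, 1, 1], by simp [Fin.forall_fin_succ], ?_⟩
  rotate_left; refine Or.inl (Or.inl ⟨0, Or.inl ?_⟩)
  rotate_left; refine Or.inl (Or.inr ⟨0, 3, by decide, Or.inl ?_⟩)
  rotate_left; refine Or.inl (Or.inr ⟨0, 2, by decide, Or.inl ?_⟩)
  rotate_left; refine Or.inl (Or.inr ⟨0, 1, by decide, Or.inl ?_⟩)
  all_goals
    ext k
    fin_cases k <;> simp [ofCoeffs, fundamental, coeffs, e, Fin.sum_univ_four] <;> try norm_num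

/-- The positive roots, numbered in increasing order. -/
noncomputable def pos (i : Fin 24) : Φ := ⟨ofCoeffs fun k => (coeffs i k : ℝ), ofCoeffs_mem i⟩

/-- An identification of the root system of `L` with respect to the Cartan subalgebra `H` with the
root system `F₄`: a bijection that preserves the Cartan integers `2 (r, s) / (s, s)`. Its existence
says that `L` is of type `F₄`. -/
structure RootIdentification {L : Type*} [LieRing L] [LieAlgebra ℂ L] [FiniteDimensional ℂ L]
    [LieAlgebra.IsSimple ℂ L] (H : LieSubalgebra ℂ L) [H.IsCartanSubalgebra] where
  toEquiv : Φ ≃ H.root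
  pairing_eq : ∀ r s : Φ,
    ((LieAlgebra.IsKilling.rootSystem H).pairingIn ℤ (toEquiv r) (toEquiv s) : ℝ) =
      2 * inner ℝ (r : V) (s : V) / inner ℝ (s : V) (s : V)

/-- The root vectors `x r` of a Chevalley basis of `L`, with their structure constants `N r s`.
The remaining elements of the basis are the coroots of the fundamental roots. -/
structure ChevalleyBasis {L : Type*} [LieRing L] [LieAlgebra ℂ L] [FiniteDimensional ℂ L]
    [LieAlgebra.IsSimple ℂ L] {H : LieSubalgebra ℂ L} [H.IsCartanSubalgebra]
    (f : RootIdentification H) where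
  /-- The root vectors. -/
  x : Φ → L
  x_mem : ∀ r, x r ∈ LieAlgebra.rootSpace H (f.toEquiv r).1
  lie_x_neg : ∀ r, ⁅x r, x (-r)⁆ = (LieAlgebra.IsKilling.coroot (f.toEquiv r).1 : L)
  /-- The structure constants. -/
  N : Φ → Φ → ℤ
  lie_x_x : ∀ r s t : Φ, (r : V) + s = t → ⁅x r, x s⁆ = N r s • x t
  /-- `N r s = ± (p + 1)`, where `p` is the greatest integer such that `s - p r` is a root. -/
  N_eq : ∀ r s : Φ, (r : V) + s ∈ Φ → ∀ p : ℕ, IsGreatest {k : ℕ | (s : V) - k • (r : V) ∈ Φ} p →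
    N r s = p + 1 ∨ N r s = -(p + 1)
  /-- By convention the structure constant is zero if `r + s` is not a root. -/
  N_eq_zero : ∀ r s : Φ, (r : V) + s ∉ Φ → N r s = 0

/-- The integers `N_{r,s}` for the positive roots `r` (row) and `s` (column); the entry is `0` where
`r + s` is not a root. The row and column with index `n - 1` belong to the root with number `n`. -/
def tablePos : Fin 24 → Fin 24 → ℤ :=
  ![![0, 1, 0, 0, 1, 0, 1, 2, 0, 0, 0, 1, 0, 1, 2, 0, 1, 2, 0, 1, 0, 0, 0, 0],
    ![-1, 0, 0, 1, 2, 1, 0, 0, 0, 0, 1, 2, 1, 0, 0, 0, 0, 1, 1, 0, 2, 0, 0, 0],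
    ![0, 0, 0, 1, 1, 2, 0, 0, 0, 0, 1, 1, 2, 0, 0, 0, -1, -1, 0, -2, 0, 0, 0, 0],
    ![0, -1, -1, 0, 0, 0, 0, 0, 0, 1, 0, 0, 0, 1, 1, 1, 0, 0, 0, 0, 0, 1, 0, 0],
    ![-1, -2, -1, 0, 0, 0, 0, 0, 0, 1, 0, -2, -1, 0, 1, 1, 0, 0, 0, 0, -2, 0, 0, 0],
    ![0, -1, -2, 0, 0, 0, 0, 0, 0, 1, 0, -1, -2, -1, -1, 0, 0, 0, 0, 2, 0, 0, 0, 0],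
    ![-1, 0, 0, 0, 0, 0, 0, 0, 0, 1, 1, 0, -1, 0, 0, 1, 0, 0, 1, 0, 0, 0, 0, 0],
    ![-2, 0, 0, 0, 0, 0, 0, 0, 0, 1, 1, 1, -1, 0, -2, 0, 0, -2, 0, 0, 0, 0, 0, 0],
    ![0, 0, 0, 0, 0, 0, 0, 0, 0, 1, 1, 1, 0, 1, 0, 0, 1, 0, 0, 0, 0, 0, 0, 0],
    ![0, 0, 0, -1, -1, -1, -1, -1, -1, 0, 0, 0, 0, 0, 0, 0, 0, 0, 0, 0, 0, 0, 1, 0],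
    ![0, -1, -1, 0, 0, 0, -1, -1, -1, 0, 0, 0, 0, 0, 0, 0, 0, 0, 0, 0, 0, -1, 0, 0],
    ![-1, -2, -1, 0, 2, 1, 0, -1, -1, 0, 0, 0, 0, 0, 0, 0, 0, 0, 0, 0, 2, 0, 0, 0],
    ![0, -1, -2, 0, 1, 2, 1, 1, 0, 0, 0, 0, 0, 0, 0, 0, 0, 0, 0, -2, 0, 0, 0, 0],
    ![-1, 0, 0, -1, 0, 1, 0, 0, -1, 0, 0, 0, 0, 0, 0, 0, 0, 0, -1, 0, 0, 0, 0, 0],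
    ![-2, 0, 0, -1, -1, 1, 0, 2, 0, 0, 0, 0, 0, 0, 0, 0, 0, 2, 0, 0, 0, 0, 0, 0],
    ![0, 0, 0, -1, -1, 0, -1, 0, 0, 0, 0, 0, 0, 0, 0, 0, -1, 0, 0, 0, 0, 0, 0, 0],
    ![-1, 0, 1, 0, 0, 0, 0, 0, -1, 0, 0, 0, 0, 0, 0, 1, 0, 0, 0, 0, 0, 0, 0, 0],
    ![-2, -1, 1, 0, 0, 0, 0, 2, 0, 0, 0, 0, 0, 0, -2, 0, 0, 0, 0, 0, 0, 0, 0, 0],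
    ![0, -1, 0, 0, 0, 0, -1, 0, 0, 0, 0, 0, 0, 1, 0, 0, 0, 0, 0, 0, 0, 0, 0, 0],
    ![-1, 0, 2, 0, 0, -2, 0, 0, 0, 0, 0, 0, 2, 0, 0, 0, 0, 0, 0, 0, 0, 0, 0, 0],
    ![0, -2, 0, 0, 2, 0, 0, 0, 0, 0, 0, -2, 0, 0, 0, 0, 0, 0, 0, 0, 0, 0, 0, 0],
    ![0, 0, 0, -1, 0, 0, 0, 0, 0, 0, 1, 0, 0, 0, 0, 0, 0, 0, 0, 0, 0, 0, 0, 0],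
    ![0, 0, 0, 0, 0, 0, 0, 0, 0, -1, 0, 0, 0, 0, 0, 0, 0, 0, 0, 0, 0, 0, 0, 0],
    ![0, 0, 0, 0, 0, 0, 0, 0, 0, 0, 0, 0, 0, 0, 0, 0, 0, 0, 0, 0, 0, 0, 0, 0]]

/-- The integers `N_{r,-s}` for the positive roots `r` (row) and `s` (column) with `r ≺ s`; the entry
is `0` where `r - s` is not a root. The entries on and below the diagonal have no meaning. -/
def tableNeg : Fin 24 → Fin 24 → ℤ :=
  ![![0, 0, -1, 0, 0, -1, 0, -2, -1, 0, 0, 0, -1, 0, -2, -1, 0, -2, -1, 0, -1, 0, 0, 0],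
    ![0, 0, 1, 0, -2, 0, -1, -1, 0, 0, 0, -2, 0, -1, -1, 0, 0, 0, 0, -1, -2, -1, 0, 0],
    ![0, 0, 0, 0, 0, -2, 0, -1, -1, 0, 0, 0, -2, 0, -1, -1, 0, 0, 0, 2, 1, 1, 0, 0],
    ![0, 0, 0, 0, 1, 1, 0, 0, 0, 0, -1, 0, 0, 0, 0, 0, -1, -1, -1, 0, 0, 0, -1, 0],
    ![0, 0, 0, 0, 0, 1, 1, 1, 0, 0, 0, -2, 0, 0, 0, 0, 1, 1, 0, -1, -2, 0, 1, 0],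
    ![0, 0, 0, 0, 0, 0, 0, 1, 1, 0, 0, 0, -2, 0, 0, 0, 0, 1, 1, 2, 1, 0, -1, 0],
    ![0, 0, 0, 0, 0, 0, 0, 1, 0, 0, 0, 0, 0, -1, 0, 0, -1, 0, 0, 1, 0, -1, -1, 0],
    ![0, 0, 0, 0, 0, 0, 0, 0, 1, 0, 0, 0, 0, 0, -2, 0, 0, -2, 0, -1, 1, 1, 1, 0],
    ![0, 0, 0, 0, 0, 0, 0, 0, 0, 0, 0, 0, 0, 0, 0, -1, 0, 0, -1, 0, -1, -1, -1, 0],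
    ![0, 0, 0, 0, 0, 0, 0, 0, 0, 0, 1, 1, 1, 1, 1, 1, 0, 0, 0, 0, 0, 0, 0, -1],
    ![0, 0, 0, 0, 0, 0, 0, 0, 0, 0, 0, 1, 1, 0, 0, 0, 1, 1, 1, 0, 0, 0, 0, 1],
    ![0, 0, 0, 0, 0, 0, 0, 0, 0, 0, 0, 0, 1, 1, 1, 0, -1, -1, 0, 1, 2, 0, 0, -1],
    ![0, 0, 0, 0, 0, 0, 0, 0, 0, 0, 0, 0, 0, 0, 1, 1, 0, -1, -1, -2, -1, 0, 0, 1],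
    ![0, 0, 0, 0, 0, 0, 0, 0, 0, 0, 0, 0, 0, 0, 1, 0, 1, 0, 0, -1, 0, 1, 0, 1],
    ![0, 0, 0, 0, 0, 0, 0, 0, 0, 0, 0, 0, 0, 0, 0, 1, 0, 2, 0, 1, -1, -1, 0, -1],
    ![0, 0, 0, 0, 0, 0, 0, 0, 0, 0, 0, 0, 0, 0, 0, 0, 0, 0, 1, 0, 1, 1, 0, 1],
    ![0, 0, 0, 0, 0, 0, 0, 0, 0, 0, 0, 0, 0, 0, 0, 0, 0, 1, 0, -1, 0, 0, 1, -1],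
    ![0, 0, 0, 0, 0, 0, 0, 0, 0, 0, 0, 0, 0, 0, 0, 0, 0, 0, 1, 1, -1, 0, -1, 1],
    ![0, 0, 0, 0, 0, 0, 0, 0, 0, 0, 0, 0, 0, 0, 0, 0, 0, 0, 0, 0, 1, 0, 1, -1],
    ![0, 0, 0, 0, 0, 0, 0, 0, 0, 0, 0, 0, 0, 0, 0, 0, 0, 0, 0, 0, 1, -1, 1, -1],
    ![0, 0, 0, 0, 0, 0, 0, 0, 0, 0, 0, 0, 0, 0, 0, 0, 0, 0, 0, 0, 0, 1, -1, 1],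
    ![0, 0, 0, 0, 0, 0, 0, 0, 0, 0, 0, 0, 0, 0, 0, 0, 0, 0, 0, 0, 0, 0, 1, -1],
    ![0, 0, 0, 0, 0, 0, 0, 0, 0, 0, 0, 0, 0, 0, 0, 0, 0, 0, 0, 0, 0, 0, 0, 1],
    ![0, 0, 0, 0, 0, 0, 0, 0, 0, 0, 0, 0, 0, 0, 0, 0, 0, 0, 0, 0, 0, 0, 0, 0]]

end F4

/-! The structure constants obey relations forced by the Jacobi identity, and these leave only the
signs on extraspecial pairs free.

Three kinds of Jacobi identity are used. For root vectors no two of which are opposite,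
`const_jacobi` gives a three-term quadratic relation between constants. For `r + s = u`, the vectors
of `r`, `s`, `-u` give a linear relation between three coroots; since `r` and `s` are linearly
independent, comparing coefficients shows that the three constants are proportional to squared
lengths (`const_rotate`). For `r`, `-r`, `s`, the identity evaluates a combination of two products
of constants as a Cartan integer (`const_mul_const_neg`).

Whenever `r + s` is a root, `s - 2r` is not one, because roots have squared length 1 or 2. Hence `N
r s` is `±1` or `±2`, according to whether `s - r` is a root. The third identity gives `N r s * N
(-r) (-s) < 0`, and equality of absolute values turns this into `N (-r) (-s) = -N r s`.

On the 20 extraspecial pairs, one for each positive root that is not fundamental, positivity fixes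
the value. The other 48 special pairs are reached one at a time: `jacobiTriples` lists positive
triples whose Jacobi identity contains exactly one constant not yet known, multiplied by a known
nonzero one. The check that this propagation covers the whole table is a finite computation
(`settled_jacobiTriples`), and `eq_tablePos` turns it into a uniqueness statement. Finally, if `r_j
- r_i = r_k`, then `const_rotate` expresses `N_{r_i,-r_j}` through `N_{r_k,r_i}`, which yields the
second table. -/

namespace F4

open LieAlgebra LieAlgebra.IsKilling

/-! ### Squared lengths of roots -/

theorem e_mem (i : Fin 4) : e i ∈ Φ := Or.inl (Or.inl ⟨i, Or.inl rfl⟩)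

theorem inner_e_left (i : Fin 4) (v : V) : inner ℝ (e i) v = v i := by
  simp [e, EuclideanSpace.inner_single_left]

theorem norm_sq_eq (v : V) : inner ℝ v v = v 0 ^ 2 + v 1 ^ 2 + v 2 ^ 2 + v 3 ^ 2 := by
  rw [PiLp.inner_apply, Fin.sum_univ_four]
  simp only [RCLike.inner_apply, conj_trivial]
  ring

/-- Roots of `F₄` have squared length `1` or `2`. -/
theorem inner_self_of_mem {v : V} (hv : v ∈ Φ) : inner ℝ v v = (1 : ℝ) ∨ inner ℝ v v = (2 : ℝ) := by
  rcases hv with (⟨i, h⟩ | ⟨i, j, hij, h⟩) | ⟨σ, hσ, rfl⟩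
  · left
    rcases h with rfl | rfl <;> simp [e]
  · right
    have hji := hij.symm
    rcases h with rfl | rfl | rfl <;>
      simp only [e, inner_add_left, inner_add_right, inner_sub_left, inner_sub_right,
        inner_neg_left, inner_neg_right] <;>
      simp [EuclideanSpace.inner_single_left, hij, hji] <;> norm_num
  · left
    have h2 : ∀ i, σ i ^ 2 = 1 := fun i => by rcases hσ i with h | h <;> simp [h]
    rw [norm_sq_eq]
    simp [e, Fin.sum_univ_four]
    have := h2 0; have := h2 1; have := h2 2; have := h2 3
    linarith

theorem eq_zero_of_inner_eq_zero {w : V} (h : ∀ v ∈ Φ, inner ℝ v w = (0 : ℝ)) : w = 0 := by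
  ext i
  simpa [inner_e_left] using h (e i) (e_mem i)

theorem inner_self_pos {v : V} (hv : v ∈ Φ) : (0 : ℝ) < inner ℝ v v := by
  rcases inner_self_of_mem hv with h | h <;> rw [h] <;> norm_num

theorem zero_notMem : (0 : V) ∉ Φ := fun h => by simpa using inner_self_pos h

@[simp] theorem coe_neg (r : Φ) : ((-r : Φ) : V) = -(r : V) := rfl

theorem neg_neg_root (r : Φ) : - -r = r := Subtype.ext (by simp)

theorem norm_add (v w : V) :
    inner ℝ (v + w) (v + w) = inner ℝ v v + 2 * inner ℝ v w + inner ℝ w w := by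
  rw [inner_add_left, inner_add_right, inner_add_right, real_inner_comm v w]; ring

variable {L : Type*} [LieRing L] [LieAlgebra ℂ L] [FiniteDimensional ℂ L]
  [LieAlgebra.IsSimple ℂ L] {H : LieSubalgebra ℂ L} [H.IsCartanSubalgebra]
  {f : RootIdentification H}

/-! ### Additive relations between roots, recovered from Cartan integers -/

namespace RootIdentification

/-- The Cartan integer `2 (r, s) / (s, s)`. -/
noncomputable def cartan (f : RootIdentification H) (r s : Φ) : ℤ :=
  (rootSystem H).pairingIn ℤ (f.toEquiv r) (f.toEquiv s)

theorem cartan_eq (f : RootIdentification H) (r s : Φ) :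
    (f.cartan r s : ℝ) = 2 * inner ℝ (r : V) (s : V) / inner ℝ (s : V) (s : V) :=
  f.pairing_eq r s

theorem apply_coroot (f : RootIdentification H) (r s : Φ) :
    (f.toEquiv r).1 (coroot (f.toEquiv s).1) = (f.cartan r s : ℂ) := by
  rw [← rootSystem_pairing_apply, cartan, ← (rootSystem H).algebraMap_pairingIn ℤ]
  simp

/-- Linear relations between Cartan integers come from relations between roots. -/
theorem add_eq_of_root_add_eq (f : RootIdentification H) {r s t : Φ}
    (h : ∀ x, (f.toEquiv r).1 x + (f.toEquiv s).1 x = (f.toEquiv t).1 x) : (r : V) + s = t := by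
  -- The identification is not assumed linear. Evaluating at the coroot of `v` gives Cartan integers
  -- with common denominator `(v, v)`, so `r + s - t` is orthogonal to every root `v`, and the roots
  -- span.
  have key : (r : V) + s - t = 0 := eq_zero_of_inner_eq_zero fun v hv => by
    have h1 := h (coroot (f.toEquiv ⟨v, hv⟩).1)
    simp only [apply_coroot] at h1
    have h2 : (f.cartan r ⟨v, hv⟩ : ℝ) + f.cartan s ⟨v, hv⟩ = f.cartan t ⟨v, hv⟩ := by
      exact_mod_cast h1
    simp only [cartan_eq] at h2
    have h3 := (inner_self_pos hv).ne'
    field_simp at h2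
    rw [inner_sub_right, inner_add_right, real_inner_comm, real_inner_comm (s : V), real_inner_comm (t : V)]
    linarith
  exact sub_eq_zero.mp key

theorem add_eq_zero_of_root_add_eq_zero (f : RootIdentification H) {r s : Φ}
    (h : ∀ x, (f.toEquiv r).1 x + (f.toEquiv s).1 x = 0) : (r : V) + s = 0 := by
  refine eq_zero_of_inner_eq_zero fun v hv => ?_
  have h1 := h (coroot (f.toEquiv ⟨v, hv⟩).1)
  simp only [apply_coroot] at h1
  have h2 : (f.cartan r ⟨v, hv⟩ : ℝ) + f.cartan s ⟨v, hv⟩ = 0 := by exact_mod_cast h1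
  simp only [cartan_eq] at h2
  have h3 := (inner_self_pos hv).ne'
  field_simp at h2
  rw [inner_add_right, real_inner_comm, real_inner_comm (s : V)]
  linarith

end RootIdentification

/-! ### Jacobi identities for root vectors -/

namespace ChevalleyBasis

theorem x_ne_zero (B : ChevalleyBasis f) (r : Φ) : B.x r ≠ 0 := by
  intro h
  have h1 := B.lie_x_neg r
  rw [h, zero_lie] at h1
  have h2 : coroot (f.toEquiv r).1 = 0 := by exact_mod_cast h1.symm
  have h3 := (f.toEquiv r).2
  rw [coroot_eq_zero_iff] at h2
  exact (Finset.mem_filter.mp h3).2 h2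

theorem smul_x_injective (B : ChevalleyBasis f) (r : Φ) {m n : ℤ} (h : m • B.x r = n • B.x r) :
    m = n := by
  rw [← Int.cast_smul_eq_zsmul ℂ, ← Int.cast_smul_eq_zsmul ℂ] at h
  exact_mod_cast smul_left_injective ℂ (B.x_ne_zero r) h

theorem lie_coroot_x (B : ChevalleyBasis f) (r s : Φ) :
    ⁅(coroot (f.toEquiv s).1 : L), B.x r⁆ = f.cartan r s • B.x r := by
  have h := lie_eq_smul_of_mem_rootSpace (B.x_mem r) (coroot (f.toEquiv s).1)
  rw [f.apply_coroot] at h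
  rw [← Int.cast_smul_eq_zsmul ℂ, ← h]
  rfl

/-- A nonzero bracket would make the sum of the two roots of `H` a weight: the zero weight forces `r
+ s = 0`, and a nonzero one is a root, which forces `r + s ∈ Φ`. -/
theorem lie_x_eq_zero (B : ChevalleyBasis f) {r s : Φ} (h0 : (r : V) + s ≠ 0)
    (h : (r : V) + s ∉ Φ) : ⁅B.x r, B.x s⁆ = 0 := by
  by_contra hne
  have hmem := lie_mem_genWeightSpace_of_mem_genWeightSpace (B.x_mem r) (B.x_mem s)
  let χ : LieModule.Weight ℂ H L := ⟨(f.toEquiv r).1 + (f.toEquiv s).1, fun hbot => hne (by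
    rw [hbot] at hmem; simpa using hmem)⟩
  by_cases hχ : χ.IsZero
  · exact h0 (f.add_eq_zero_of_root_add_eq_zero fun x => congrFun hχ x)
  · let t : H.root := ⟨χ, by simpa using hχ⟩
    have := f.add_eq_of_root_add_eq (r := r) (s := s) (t := f.toEquiv.symm t) fun x => by
      rw [Equiv.apply_symm_apply]; rfl
    exact h (this ▸ (f.toEquiv.symm t).2)

open Classical in
/-- The root vector of `v`, extended by zero to all vectors of the Euclidean space. -/
noncomputable def vec (B : ChevalleyBasis f) (v : V) : L := if h : v ∈ Φ then B.x ⟨v, h⟩ else 0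

open Classical in
/-- The structure constants, extended by zero to all vectors of the Euclidean space. -/
noncomputable def const (B : ChevalleyBasis f) (v w : V) : ℤ :=
  if h : v ∈ Φ ∧ w ∈ Φ then B.N ⟨v, h.1⟩ ⟨w, h.2⟩ else 0

theorem vec_coe (B : ChevalleyBasis f) (r : Φ) : B.vec r = B.x r := by simp [vec]

theorem const_coe (B : ChevalleyBasis f) (r s : Φ) : B.const r s = B.N r s := by simp [const]

/-- Thanks to the extension by zero, Jacobi identities can be expanded without asking which partial
sums are roots. Only opposite vectors must be excluded, as their bracket is a coroot. -/
theorem lie_vec (B : ChevalleyBasis f) {v w : V} (h : v + w ≠ 0) :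
    ⁅B.vec v, B.vec w⁆ = B.const v w • B.vec (v + w) := by
  by_cases hv : v ∈ Φ
  · by_cases hw : w ∈ Φ
    · lift v to Φ using hv
      lift w to Φ using hw
      by_cases hvw : (v : V) + w ∈ Φ
      · rw [vec_coe, vec_coe, const_coe, B.lie_x_x v w ⟨_, hvw⟩ rfl, ← B.vec_coe]
      · rw [vec_coe, vec_coe, B.lie_x_eq_zero h hvw, vec, dif_neg hvw, smul_zero]
    · simp [vec, const, hw]
  · simp [vec, const, hv]

theorem const_eq_zero (B : ChevalleyBasis f) {v w : V} (h : v + w ∉ Φ) : B.const v w = 0 := by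
  unfold const
  split_ifs with h1
  · exact B.N_eq_zero _ _ h
  · rfl

theorem smul_vec_injective (B : ChevalleyBasis f) {v : V} (hv : v ∈ Φ) {m n : ℤ}
    (h : m • B.vec v = n • B.vec v) : m = n := by
  lift v to Φ using hv
  rw [vec_coe] at h
  exact B.smul_x_injective v h

theorem const_swap (B : ChevalleyBasis f) (v w : V) : B.const w v = -B.const v w := by
  by_cases h : v + w ∈ Φ
  · have h0 : v + w ≠ 0 := fun h0 => zero_notMem (h0 ▸ h)
    apply B.smul_vec_injective h
    rw [neg_smul, ← B.lie_vec h0, lie_skew, B.lie_vec (add_comm v w ▸ h0), add_comm v w]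
  · rw [B.const_eq_zero h, B.const_eq_zero (add_comm v w ▸ h), neg_zero]

theorem N_swap (B : ChevalleyBasis f) (r s : Φ) : B.N s r = -B.N r s := by
  simpa [const_coe] using B.const_swap r s

/-- The Jacobi identity for three root vectors no two of which are opposite. -/
theorem const_jacobi (B : ChevalleyBasis f) {u v w : V} (huv : u + v ≠ 0) (hvw : v + w ≠ 0)
    (hwu : w + u ≠ 0) :
    B.const v w * B.const u (v + w) + B.const w u * B.const v (w + u) +
      B.const u v * B.const w (u + v) = 0 := by
  have e1 : v + (w + u) = u + (v + w) := by abel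
  have e2 : w + (u + v) = u + (v + w) := by abel
  by_cases h : u + (v + w) ∈ Φ
  · have h0 : u + (v + w) ≠ 0 := fun h0 => zero_notMem (h0 ▸ h)
    apply B.smul_vec_injective h
    have := lie_jacobi (B.vec u) (B.vec v) (B.vec w)
    rw [B.lie_vec hvw, B.lie_vec hwu, B.lie_vec huv, lie_zsmul, lie_zsmul, lie_zsmul, B.lie_vec h0,
      B.lie_vec (e1 ▸ h0), B.lie_vec (e2 ▸ h0), e1, e2, smul_smul, smul_smul, smul_smul,
      ← add_smul, ← add_smul] at this
    rw [this, zero_smul]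
  · rw [B.const_eq_zero h, B.const_eq_zero (v := v) (w := w + u) (by rwa [e1]),
      B.const_eq_zero (v := w) (w := u + v) (by rwa [e2])]
    simp

/-- The Jacobi identity for `x r`, `x (-r)` and a third root vector. -/
theorem const_mul_const_neg (B : ChevalleyBasis f) {r s : Φ} (h : (r : V) + s ≠ 0)
    (h' : (s : V) - r ≠ 0) :
    B.const (-r) s * B.const r (s - r) + B.const s r * B.const (-r) (r + s) = f.cartan s r := by
  have h1 : (s : V) + r ≠ 0 := by rwa [add_comm]
  have h2 : -(r : V) + s ≠ 0 := by rwa [neg_add_eq_sub]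
  have e1 : (r : V) + (-r + s) = s := by abel
  have e2 : -(r : V) + (s + r) = s := by abel
  have hs : (s : V) ≠ 0 := fun h0 => zero_notMem (h0 ▸ s.2)
  have := lie_jacobi (B.vec r) (B.vec (-r)) (B.vec s)
  rw [B.lie_vec h2, B.lie_vec h1, lie_zsmul, lie_zsmul, B.lie_vec (e1.symm ▸ hs),
    B.lie_vec (e2.symm ▸ hs), e1, e2, ← coe_neg, vec_coe, vec_coe, vec_coe, B.lie_x_neg,
    ← lie_skew, lie_coroot_x, smul_smul, smul_smul, ← add_smul, ← sub_eq_add_neg,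
    sub_eq_zero] at this
  rw [← B.smul_x_injective s this, coe_neg, neg_add_eq_sub, add_comm (s : V)]

/-- Structure constants of three roots with sum zero, up to the scaling by squared lengths. -/
theorem const_rotate (B : ChevalleyBasis f) {r s u : Φ} (h : (r : V) + s = u) :
    (B.N r s : ℝ) / inner ℝ (u : V) (u : V) = B.N s (-u) / inner ℝ (r : V) (r : V) ∧
    (B.N r s : ℝ) / inner ℝ (u : V) (u : V) = B.N (-u) r / inner ℝ (s : V) (s : V) := by
  -- The Jacobi identity for `r`, `s`, `-u` is a linear relation between the coroots of `u`, `r`,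
  -- `s`; bracketing it with `x α` reads off its value at the root `α`.
  have key : ∀ α : Φ, B.N r s * f.cartan α u = B.N s (-u) * f.cartan α r + B.N (-u) r * f.cartan α s := by
    intro α
    have j := lie_jacobi (B.x r) (B.x s) (B.x (-u))
    rw [B.lie_x_x r s u h, B.lie_x_x s (-u) (-r) (by simp [← h]),
      B.lie_x_x (-u) r (-s) (by simp [← h]), lie_zsmul, lie_zsmul, lie_zsmul, B.lie_x_neg,
      B.lie_x_neg, ← lie_skew, B.lie_x_neg] at j
    have j2 := congrArg (fun z => ⁅z, B.x α⁆) j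
    simp only [smul_neg, add_lie, neg_lie, zsmul_lie, zero_lie, lie_coroot_x, smul_smul] at j2
    rw [← sub_eq_add_neg, ← add_smul, ← sub_smul] at j2
    have := B.smul_x_injective α (j2.trans (zero_smul ℤ _).symm)
    linarith
  have hr := key r
  have hs := key s
  have a1 := inner_self_pos r.2
  have a2 := inner_self_pos s.2
  have a3 := inner_self_pos u.2
  have hr' : (B.N r s : ℝ) * f.cartan r u = B.N s (-u) * f.cartan r r + B.N (-u) r * f.cartan r s := by
    exact_mod_cast hr
  have hs' : (B.N r s : ℝ) * f.cartan s u = B.N s (-u) * f.cartan s r + B.N (-u) r * f.cartan s s := by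
    exact_mod_cast hs
  simp only [f.cartan_eq] at hr' hs'
  have nu := norm_add (r : V) s
  rw [h] at nu
  have iru : inner ℝ (r : V) (u : V) = inner ℝ (r : V) (r : V) + inner ℝ (r : V) (s : V) := by
    rw [← h, inner_add_right]
  have isu : inner ℝ (s : V) (u : V) = inner ℝ (r : V) (s : V) + inner ℝ (s : V) (s : V) := by
    rw [← h, inner_add_right, real_inner_comm]
  rw [iru] at hr'
  rw [isu, real_inner_comm (r : V) (s : V)] at hs'
  -- The Gram determinant of `r` and `s`. The three squared lengths determine the inner product,
  -- which leaves eight cases.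
  have det : inner ℝ (r : V) (r : V) * inner ℝ (s : V) (s : V) - inner ℝ (r : V) (s : V) ^ 2 ≠ 0 := by
    have hp : inner ℝ (r : V) (s : V) =
        (inner ℝ (u : V) (u : V) - inner ℝ (r : V) (r : V) - inner ℝ (s : V) (s : V)) / 2 := by linarith
    rw [hp]
    rcases inner_self_of_mem r.2 with h1 | h1 <;> rcases inner_self_of_mem s.2 with h2 | h2 <;>
      rcases inner_self_of_mem u.2 with h3 | h3 <;> rw [h1, h2, h3] <;> norm_num
  generalize inner ℝ (r : V) (s : V) = p at *
  generalize inner ℝ (r : V) (r : V) = a at *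
  generalize inner ℝ (s : V) (s : V) = b at *
  generalize inner ℝ (u : V) (u : V) = c at *
  set X := (B.N r s : ℝ) / c with hX
  set Y := (B.N s (-u) : ℝ) / a with hY
  set Z := (B.N (-u) r : ℝ) / b with hZ
  -- The relations for `α = r` and `α = s` form a homogeneous system in `X - Y` and `X - Z` with the
  -- Gram matrix as coefficients.
  have E1 : (X - Y) * a + (X - Z) * p = 0 := by
    have : X * (a + p) = Y * a + Z * p := by
      rw [hX, hY, hZ]; field_simp; field_simp at hr'; linarith
    linarith
  have E2 : (X - Y) * p + (X - Z) * b = 0 := by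
    have : X * (p + b) = Y * p + Z * b := by
      rw [hX, hY, hZ]; field_simp; field_simp at hs'; linarith
    linarith
  constructor
  · have : (X - Y) * (a * b - p ^ 2) = 0 := by linear_combination b * E1 - p * E2
    rcases mul_eq_zero.mp this with h | h
    · linarith
    · exact absurd h det
  · have : (X - Z) * (a * b - p ^ 2) = 0 := by linear_combination a * E2 - p * E1
    rcases mul_eq_zero.mp this with h | h
    · linarith
    · exact absurd h det

end ChevalleyBasis

end F4

/-! ### Root strings, absolute values, and the sign under negation -/

namespace F4

/-- If `r + s` is a root, then `r` and `s` form an obtuse angle or are orthogonal. -/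
theorem inner_nonpos_of_add_mem {v w : V} (hv : v ∈ Φ) (hw : w ∈ Φ) (h : v + w ∈ Φ) :
    inner ℝ v w ≤ (0 : ℝ) := by
  have := norm_add v w
  rcases inner_self_of_mem hv with h1 | h1 <;> rcases inner_self_of_mem hw with h2 | h2 <;>
    rcases inner_self_of_mem h with h3 | h3 <;> rw [h1, h2, h3] at this <;> linarith

theorem norm_sub_nsmul (v w : V) (k : ℕ) :
    inner ℝ (w - k • v) (w - k • v) = inner ℝ w w - 2 * k * inner ℝ v w + k ^ 2 * inner ℝ v v := by
  rw [← Nat.cast_smul_eq_nsmul ℝ, inner_sub_left, inner_sub_right, inner_sub_right,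
    inner_smul_left, inner_smul_right, inner_smul_left, inner_smul_right, real_inner_comm v w]
  simp only [conj_trivial]
  ring

/-- As `v` and `w` do not form an acute angle, `w - k v` with `k ≥ 2` has squared length at least `1
+ 4`, too long for a root. So the integer `p` of a Chevalley basis is 0 or 1. -/
theorem le_one_of_sub_nsmul_mem {v w : V} (hv : v ∈ Φ) (hw : w ∈ Φ) (h : v + w ∈ Φ) {k : ℕ}
    (hk : w - k • v ∈ Φ) : k ≤ 1 := by
  by_contra! h2
  have h0 := inner_nonpos_of_add_mem hv hw h
  have h1 := norm_sub_nsmul v w k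
  have h3 : (1 : ℝ) ≤ inner ℝ v v := by rcases inner_self_of_mem hv with h | h <;> rw [h]; norm_num
  have h4 : (1 : ℝ) ≤ inner ℝ w w := by rcases inner_self_of_mem hw with h | h <;> rw [h]; norm_num
  have h5 : inner ℝ (w - k • v) (w - k • v) ≤ (2 : ℝ) := by
    rcases inner_self_of_mem hk with h | h <;> rw [h]; norm_num
  have h6 : (2 : ℝ) ≤ k := by exact_mod_cast h2
  nlinarith [mul_nonneg (Nat.cast_nonneg k : (0 : ℝ) ≤ k) (neg_nonneg.mpr h0)]

variable {L : Type*} [LieRing L] [LieAlgebra ℂ L] [FiniteDimensional ℂ L]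
  [LieAlgebra.IsSimple ℂ L] {H : LieSubalgebra ℂ L} [H.IsCartanSubalgebra]
  {f : RootIdentification H}

namespace ChevalleyBasis

theorem N_eq_of_sub_notMem (B : ChevalleyBasis f) {r s : Φ} (h : (r : V) + s ∈ Φ)
    (h' : (s : V) - r ∉ Φ) : B.N r s = 1 ∨ B.N r s = -1 := by
  have := B.N_eq r s h 0 ⟨by simp, fun k hk => by
    have h1 : k ≤ 1 := le_one_of_sub_nsmul_mem r.2 s.2 h hk
    interval_cases k
    · exact le_rfl
    · simp [h'] at hk⟩
  simpa using this

theorem N_eq_of_sub_mem (B : ChevalleyBasis f) {r s : Φ} (h : (r : V) + s ∈ Φ)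
    (h' : (s : V) - r ∈ Φ) : B.N r s = 2 ∨ B.N r s = -2 := by
  have := B.N_eq r s h 1 ⟨by simpa using h', fun k hk => le_one_of_sub_nsmul_mem r.2 s.2 h hk⟩
  simpa using this

theorem N_ne_zero (B : ChevalleyBasis f) {r s : Φ} (h : (r : V) + s ∈ Φ) : B.N r s ≠ 0 := by
  by_cases h' : (s : V) - r ∈ Φ
  · rcases B.N_eq_of_sub_mem h h' with h | h <;> rw [h] <;> norm_num
  · rcases B.N_eq_of_sub_notMem h h' with h | h <;> rw [h] <;> norm_num

/-- The relation between the products `N r s * N (-r) (-s)` along a root string. -/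
theorem const_mul_const_neg_eq (B : ChevalleyBasis f) {r s u : Φ} (h : (r : V) + s = u) :
    (B.const (-r) s * B.const r (s - r) : ℝ) +
      inner ℝ (s : V) (s : V) / inner ℝ (u : V) (u : V) * (B.N r s * B.N (-r) (-s)) =
      2 * inner ℝ (r : V) (s : V) / inner ℝ (r : V) (r : V) := by
  have hu : (r : V) + s ∈ Φ := h ▸ u.2
  have h0 : (r : V) + s ≠ 0 := fun h0 => zero_notMem (h0 ▸ hu)
  have h1 : (s : V) - r ≠ 0 := fun h1 => by
    have h2 := inner_nonpos_of_add_mem r.2 s.2 hu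
    rw [sub_eq_zero.mp h1] at h2
    exact h2.not_gt (inner_self_pos r.2)
  have j := B.const_mul_const_neg h0 h1
  -- Rotation of the triple `-r`, `u`, `-s` replaces `N (-r) u` by a multiple of `N (-r) (-s)`.
  have k := (B.const_rotate (r := -r) (s := u) (u := s) (by simp [← h])).2
  rw [h, ← coe_neg, B.const_coe s r, B.const_coe (-r) u, B.N_swap r s] at j
  rw [B.N_swap (-r) (-s)] at k
  have j' : (B.const ((-r : Φ) : V) s * B.const r (s - r) : ℝ) + -B.N r s * B.N (-r) u =
    f.cartan s r := by exact_mod_cast j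
  rw [f.cartan_eq, real_inner_comm] at j'
  rw [← j', coe_neg, add_right_inj]
  have a1 := (inner_self_pos s.2).ne'
  have a2 := (inner_self_pos u.2).ne'
  push_cast at k
  rw [div_eq_iff a1] at k
  rw [k]
  field_simp

/-- At the start of the `r`-string the first product in `const_mul_const_neg_eq` vanishes, and the
right-hand side is nonpositive. -/
theorem N_mul_N_neg_lt_zero_of_sub_notMem (B : ChevalleyBasis f) {r s : Φ}
    (h : (r : V) + s ∈ Φ) (h' : (s : V) - r ∉ Φ) : (B.N r s * B.N (-r) (-s) : ℝ) < 0 := by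
  have k := B.const_mul_const_neg_eq (u := ⟨_, h⟩) rfl
  rw [B.const_eq_zero (v := -(r : V)) (by rwa [neg_add_eq_sub])] at k
  have h1 := inner_nonpos_of_add_mem r.2 s.2 h
  have a := inner_self_pos r.2
  have b := inner_self_pos s.2
  have c := inner_self_pos h
  have hne : (B.N r s * B.N (-r) (-s) : ℝ) ≠ 0 := by
    have h2 := B.N_ne_zero h
    have h3 : B.N (-r) (-s) ≠ 0 := B.N_ne_zero (by simpa [neg_add_eq_sub, add_comm] using neg_mem h)
    exact_mod_cast mul_ne_zero h2 h3
  refine lt_of_le_of_ne ?_ hne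
  have h4 : 2 * inner ℝ (r : V) (s : V) / inner ℝ (r : V) (r : V) ≤ 0 :=
    div_nonpos_of_nonpos_of_nonneg (by linarith) a.le
  by_contra! h5
  have := mul_pos (div_pos b c) h5
  simp only [Int.cast_zero, zero_mul, zero_add] at k
  linarith

theorem N_mul_N_neg_lt_zero (B : ChevalleyBasis f) {r s : Φ} (h : (r : V) + s ∈ Φ) :
    (B.N r s * B.N (-r) (-s) : ℝ) < 0 := by
  by_cases h' : (s : V) - r ∈ Φ
  swap
  · exact B.N_mul_N_neg_lt_zero_of_sub_notMem h h'
  have k := B.const_mul_const_neg_eq (u := ⟨_, h⟩) rfl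
  have h1 := inner_nonpos_of_add_mem r.2 s.2 h
  have a := inner_self_pos r.2
  have b := inner_self_pos s.2
  have c := inner_self_pos h
  have d := inner_self_pos h'
  set w : Φ := ⟨_, h'⟩ with hw
  have hrw : (r : V) + w = s := by simp [hw]
  -- The root `w = s - r` starts the string, since `w - r = s - 2r` is not a root. Rotating `-r`,
  -- `s`, `-w` then makes the first product in `k` positive, so the second has to be negative.
  have hneg := B.N_mul_N_neg_lt_zero_of_sub_notMem (r := r) (s := w) (by rw [hrw]; exact s.2)
    fun h2 => by
      have := le_one_of_sub_nsmul_mem r.2 s.2 h (k := 2) (by convert h2 using 1; simp [hw]; module)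
      omega
  have hrot := (B.const_rotate (r := -r) (s := s) (u := w) (by simp [hw, neg_add_eq_sub])).2
  rw [B.N_swap (-r) (-w), div_eq_div_iff d.ne' b.ne'] at hrot
  rw [show (s : V) - r = w from rfl, ← coe_neg, const_coe, const_coe] at k
  push_cast at hrot
  have h4 : 2 * inner ℝ (r : V) (s : V) / inner ℝ (r : V) (r : V) ≤ 0 :=
    div_nonpos_of_nonpos_of_nonneg (by linarith) a.le
  have h6 : (0 : ℝ) < B.N (-r) s * B.N r w := by
    have : (B.N (-r) s * B.N r w : ℝ) * inner ℝ (s : V) (s : V) =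
      -(B.N r w * B.N (-r) (-w)) * inner ℝ (w : V) (w : V) := by linear_combination B.N r w * hrot
    have h7 : (0 : ℝ) < (B.N (-r) s * B.N r w : ℝ) * inner ℝ (s : V) (s : V) := by
      rw [this]; exact mul_pos (by linarith) d
    exact pos_of_mul_pos_left h7 b.le
  by_contra! h5
  have := mul_nonneg (div_pos b c).le h5
  simp only at k
  linarith

/-- The two constants have opposite signs, and equal absolute values because `s - r` is a root
exactly when its negative is. -/
theorem N_neg_neg (B : ChevalleyBasis f) (r s : Φ) : B.N (-r) (-s) = -B.N r s := by
  by_cases h : (r : V) + s ∈ Φ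
  · have hn : ((-r : Φ) : V) + (-s : Φ) ∈ Φ := by
      simpa [neg_add_eq_sub, add_comm] using neg_mem h
    have hlt : B.N r s * B.N (-r) (-s) < 0 := by exact_mod_cast B.N_mul_N_neg_lt_zero h
    by_cases h' : (s : V) - r ∈ Φ
    · have hn' : ((-s : Φ) : V) - (-r : Φ) ∈ Φ := by
        simpa [neg_add_eq_sub] using neg_mem h'
      rcases B.N_eq_of_sub_mem h h' with h1 | h1 <;> rcases B.N_eq_of_sub_mem hn hn' with h2 | h2 <;>
        rw [h1, h2] at hlt <;> omega
    · have hn' : ((-s : Φ) : V) - (-r : Φ) ∉ Φ := fun hn' => h' <| by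
        simpa [neg_add_eq_sub] using neg_mem hn'
      rcases B.N_eq_of_sub_notMem h h' with h1 | h1 <;>
        rcases B.N_eq_of_sub_notMem hn hn' with h2 | h2 <;>
        rw [h1, h2] at hlt <;> omega
  · rw [B.N_eq_zero _ _ h, B.N_eq_zero _ _ fun hn => h ?_, neg_zero]
    simpa [neg_add_eq_sub, add_comm] using neg_mem hn

end ChevalleyBasis

end F4

/-! ### Propagation from extraspecial pairs through the table -/

namespace F4

/-- Twice the coordinates of `α a + β b + γ c + δ d` with respect to `e₁, e₂, e₃, e₄`. -/
def doubled (c : Fin 4 → ℤ) : Fin 4 → ℤ :=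
  ![c 3, 2 * c 0 - c 3, 2 * c 1 - 2 * c 0 - c 3, 2 * c 2 - 2 * c 1 - c 3]

/-- Four times the squared length of `α a + β b + γ c + δ d`. -/
def quad (c : Fin 4 → ℤ) : ℤ :=
  c 3 ^ 2 + (2 * c 0 - c 3) ^ 2 + (2 * c 1 - 2 * c 0 - c 3) ^ 2 + (2 * c 2 - 2 * c 1 - c 3) ^ 2

/-- The index of the sum of two positive roots, if this is a root. -/
def sumIndex (i j : Fin 24) : Option (Fin 24) :=
  (List.finRange 24).find? fun k => decide (coeffs k = coeffs i + coeffs j)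

theorem coeffs_of_sumIndex {i j k : Fin 24} (h : sumIndex i j = some k) :
    coeffs k = coeffs i + coeffs j := by
  simpa using List.find?_some h

/-- Length alone shows that these sums are not roots: squared lengths 1 and 2 correspond to the
values 4 and 8 of `quad`. -/
theorem quad_of_tablePos_eq_zero : ∀ i j, tablePos i j = 0 →
    quad (coeffs i + coeffs j) ≠ 4 ∧ quad (coeffs i + coeffs j) ≠ 8 := by
  decide +kernel

theorem sumIndex_isSome_iff : ∀ i j, (sumIndex i j).isSome = decide (tablePos i j ≠ 0) := by
  decide +kernel

/-- One term of the Jacobi identity for the positive roots with indices `i`, `j`, `k`. -/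
def jacobiTerm (M : Fin 24 → Fin 24 → ℤ) (i j k : Fin 24) : ℤ :=
  (sumIndex j k).elim 0 fun m => M j k * M i m

/-- The pair `(i, j)` occurs in `l` up to order, or `r_i + r_j` is not a root. -/
def settled (l : List (Fin 24 × Fin 24)) (i j : Fin 24) : Bool :=
  tablePos i j == 0 || l.contains (i, j) || l.contains (j, i)

/-- Both factors of a term of the Jacobi identity are settled. -/
def termSettled (l : List (Fin 24 × Fin 24)) (i j k : Fin 24) : Bool :=
  (sumIndex j k).all fun m => settled l j k && settled l i m

/-- If all but one of the structure constants in the Jacobi identity for `t` are settled, add the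
remaining one to the list. -/
def settleNext (l : List (Fin 24 × Fin 24)) (t : Fin 24 × Fin 24 × Fin 24) :
    List (Fin 24 × Fin 24) :=
  (sumIndex t.2.1 t.2.2).elim l fun m =>
    -- The triple is ordered cyclically so that the unknown constant sits in the first term. The
    -- table entries of both factors must be nonzero, so that the known factor can be cancelled.
    if jacobiTerm tablePos t.1 t.2.1 t.2.2 + jacobiTerm tablePos t.2.1 t.2.2 t.1 +
          jacobiTerm tablePos t.2.2 t.1 t.2.1 = 0 ∧ tablePos t.2.1 t.2.2 ≠ 0 ∧
        tablePos t.1 m ≠ 0 ∧ termSettled l t.2.1 t.2.2 t.1 = true ∧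
        termSettled l t.2.2 t.1 t.2.1 = true then
      if settled l t.2.1 t.2.2 then (t.1, m) :: l
      else if settled l t.1 m then t.2 :: l else l
    else l

/-- The extraspecial pairs. -/
def extraspecialPairs : List (Fin 24 × Fin 24) :=
  [(0, 1), (0, 4), (0, 6), (0, 7), (0, 11), (0, 13), (0, 14), (0, 16), (0, 17), (0, 19), (1, 3),
    (1, 4), (1, 10), (1, 11), (1, 17), (1, 20), (3, 9), (3, 13), (3, 21), (9, 22)]

/-- Triples of positive roots whose Jacobi identities, in this order, determine all structure
constants from those of the extraspecial pairs. -/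
def jacobiTriples : List (Fin 24 × Fin 24 × Fin 24) :=
  [(3, 0, 1), (3, 0, 13), (3, 0, 14), (9, 1, 3), (9, 1, 4), (9, 4, 0), (9, 6, 0), (9, 7, 0),
    (10, 0, 1), (11, 1, 3), (14, 1, 3), (16, 0, 1), (19, 0, 1), (19, 2, 3), (19, 5, 9), (20, 1, 3),
    (20, 4, 9), (21, 3, 9), (1, 2, 17), (1, 17, 0), (4, 5, 14), (4, 14, 0), (6, 3, 9), (6, 10, 2),
    (7, 3, 9), (7, 4, 9), (7, 5, 9), (8, 3, 9), (8, 4, 9), (8, 4, 11), (8, 11, 1), (13, 0, 4),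
    (13, 2, 5), (13, 8, 10), (13, 12, 5), (15, 1, 4), (15, 3, 13), (16, 2, 12), (17, 0, 13),
    (17, 1, 12), (17, 2, 11), (18, 1, 4), (0, 1, 5), (0, 2, 4), (0, 4, 12), (0, 5, 11), (7, 0, 13),
    (7, 0, 16)]

theorem settled_jacobiTriples :
    ∀ i j, settled (jacobiTriples.foldl settleNext extraspecialPairs) i j = true := by
  decide +kernel

section Determination

variable {M : Fin 24 → Fin 24 → ℤ}

theorem eq_tablePos_of_settled (hswap : ∀ i j, M j i = -M i j)
    (hzero : ∀ i j, tablePos i j = 0 → M i j = 0) {l : List (Fin 24 × Fin 24)}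
    (hl : ∀ p ∈ l, M p.1 p.2 = tablePos p.1 p.2) {i j : Fin 24} (h : settled l i j = true) :
    M i j = tablePos i j := by
  have hT : ∀ i j, tablePos j i = -tablePos i j := by decide +kernel
  simp only [settled, Bool.or_eq_true, beq_iff_eq, List.contains_iff_mem] at h
  rcases h with (h | h) | h
  · rw [h, hzero i j h]
  · exact hl _ h
  · rw [hswap j i, hT j i]
    exact congrArg _ (hl _ h)

theorem jacobiTerm_eq_of_termSettled (hswap : ∀ i j, M j i = -M i j)
    (hzero : ∀ i j, tablePos i j = 0 → M i j = 0) {l : List (Fin 24 × Fin 24)}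
    (hl : ∀ p ∈ l, M p.1 p.2 = tablePos p.1 p.2) {i j k : Fin 24} (h : termSettled l i j k = true) :
    jacobiTerm M i j k = jacobiTerm tablePos i j k := by
  unfold termSettled at h
  unfold jacobiTerm
  cases hs : sumIndex j k with
  | none => rfl
  | some m =>
    rw [hs, Option.all_some, Bool.and_eq_true] at h
    simp only [Option.elim_some, eq_tablePos_of_settled hswap hzero hl h.1,
      eq_tablePos_of_settled hswap hzero hl h.2]

/-- The Jacobi identities for `M` and for the table agree in their last two terms, hence in the
first product. Its settled factor is common and nonzero, so the other factors agree too. -/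
theorem eq_tablePos_of_mem_settleNext (hswap : ∀ i j, M j i = -M i j)
    (hzero : ∀ i j, tablePos i j = 0 → M i j = 0)
    (hjac : ∀ i j k, jacobiTerm M i j k + jacobiTerm M j k i + jacobiTerm M k i j = 0)
    {l : List (Fin 24 × Fin 24)} (hl : ∀ p ∈ l, M p.1 p.2 = tablePos p.1 p.2)
    (t : Fin 24 × Fin 24 × Fin 24) :
    ∀ p ∈ settleNext l t, M p.1 p.2 = tablePos p.1 p.2 := by
  obtain ⟨i, j, k⟩ := t
  unfold settleNext
  cases hs : sumIndex j k with
  | none => exact hl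
  | some m =>
    simp only [Option.elim_some]
    split_ifs with h h1 h2
    rotate_right 2
    · exact hl
    · exact hl
    all_goals
      obtain ⟨hT, hjk, him, ht, ht'⟩ := h
      have hM := hjac i j k
      rw [jacobiTerm_eq_of_termSettled hswap hzero hl ht,
        jacobiTerm_eq_of_termSettled hswap hzero hl ht'] at hM
      have key : M j k * M i m = tablePos j k * tablePos i m := by
        simp only [jacobiTerm, hs, Option.elim_some] at hM hT ⊢
        linarith
    · rw [eq_tablePos_of_settled hswap hzero hl h1] at key
      simpa [mul_left_cancel₀ hjk key] using hl
    · rw [eq_tablePos_of_settled hswap hzero hl h2] at key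
      simpa [mul_right_cancel₀ him key] using hl

/-- Antisymmetry, the Jacobi identity and the values on extraspecial pairs determine the structure
constants for positive roots. -/
theorem eq_tablePos (hswap : ∀ i j, M j i = -M i j) (hzero : ∀ i j, tablePos i j = 0 → M i j = 0)
    (hjac : ∀ i j k, jacobiTerm M i j k + jacobiTerm M j k i + jacobiTerm M k i j = 0)
    (hext : ∀ p ∈ extraspecialPairs, M p.1 p.2 = tablePos p.1 p.2) (i j : Fin 24) :
    M i j = tablePos i j := by
  have hfold : ∀ (ts : List (Fin 24 × Fin 24 × Fin 24)) (l : List (Fin 24 × Fin 24)),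
      (∀ p ∈ l, M p.1 p.2 = tablePos p.1 p.2) →
      ∀ p ∈ ts.foldl settleNext l, M p.1 p.2 = tablePos p.1 p.2 := by
    intro ts
    induction ts with
    | nil => exact fun l hl => hl
    | cons t ts ih =>
      exact fun l hl => ih _ (eq_tablePos_of_mem_settleNext hswap hzero hjac hl t)
  exact eq_tablePos_of_settled hswap hzero (hfold _ _ hext) (settled_jacobiTriples i j)

end Determination

end F4

/-! ### Integral coordinates, positive roots and extraspecial pairs -/

namespace F4

/-- The vector `α a + β b + γ c + δ d` with integral coefficients. -/
noncomputable def ofInt (c : Fin 4 → ℤ) : V := ofCoeffs fun k => (c k : ℝ)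

theorem pos_eq_ofInt (i : Fin 24) : (pos i : V) = ofInt (coeffs i) := rfl

theorem ofCoeffs_add (t u : Fin 4 → ℝ) : ofCoeffs (t + u) = ofCoeffs t + ofCoeffs u := by
  simp [ofCoeffs, add_smul, Finset.sum_add_distrib]

theorem ofCoeffs_neg (t : Fin 4 → ℝ) : ofCoeffs (-t) = -ofCoeffs t := by
  simp [ofCoeffs]

theorem ofInt_add (c d : Fin 4 → ℤ) : ofInt (c + d) = ofInt c + ofInt d := by
  rw [ofInt, ofInt, ofInt, ← ofCoeffs_add]
  congr 1
  ext k
  simp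

theorem ofInt_neg (c : Fin 4 → ℤ) : ofInt (-c) = -ofInt c := by
  rw [ofInt, ofInt, ← ofCoeffs_neg]
  congr 1
  ext k
  simp

theorem ofInt_sub (c d : Fin 4 → ℤ) : ofInt (c - d) = ofInt c - ofInt d := by
  rw [sub_eq_add_neg, ofInt_add, ofInt_neg, sub_eq_add_neg]

theorem ofCoeffs_apply (t : Fin 4 → ℝ) :
    ofCoeffs t 0 = t 3 / 2 ∧ ofCoeffs t 1 = t 0 - t 3 / 2 ∧ ofCoeffs t 2 = t 1 - t 0 - t 3 / 2 ∧
      ofCoeffs t 3 = t 2 - t 1 - t 3 / 2 := by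
  refine ⟨?_, ?_, ?_, ?_⟩ <;>
    simp [ofCoeffs, fundamental, e, Fin.sum_univ_four] <;> ring

theorem ofCoeffs_injective : Function.Injective ofCoeffs := by
  intro t u h
  obtain ⟨a0, a1, a2, a3⟩ := ofCoeffs_apply t
  obtain ⟨b0, b1, b2, b3⟩ := ofCoeffs_apply u
  rw [h] at a0 a1 a2 a3
  ext k
  fin_cases k <;> simp <;> linarith

theorem ofInt_injective : Function.Injective ofInt := by
  intro c d h
  ext k
  exact_mod_cast congrFun (ofCoeffs_injective h) k

theorem ofInt_apply (c : Fin 4 → ℤ) (k : Fin 4) : ofInt c k = doubled c k / 2 := by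
  obtain ⟨h0, h1, h2, h3⟩ := ofCoeffs_apply fun k => (c k : ℝ)
  fin_cases k <;> simp [ofInt, h0, h1, h2, h3, doubled] <;> ring

theorem inner_ofInt (c : Fin 4 → ℤ) : inner ℝ (ofInt c) (ofInt c) = (quad c : ℝ) / 4 := by
  rw [norm_sq_eq]
  simp only [ofInt_apply, doubled, quad]
  simp
  ring

theorem ofInt_notMem {c : Fin 4 → ℤ} (h : quad c ≠ 4 ∧ quad c ≠ 8) : ofInt c ∉ Φ := by
  intro hc
  rcases inner_self_of_mem hc with h1 | h1 <;> rw [inner_ofInt] at h1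
  · exact h.1 (by exact_mod_cast (by linarith : (quad c : ℝ) = 4))
  · exact h.2 (by exact_mod_cast (by linarith : (quad c : ℝ) = 8))

theorem eq_pos_or_eq_neg_pos_of_doubled {v : V} {w : Fin 4 → ℤ} (hv : ∀ k, v k = w k / 2)
    (h : ∃ i, doubled (coeffs i) = w ∨ doubled (coeffs i) = -w) :
    ∃ i, v = pos i ∨ v = -(pos i : V) := by
  obtain ⟨i, h | h⟩ := h
  · refine ⟨i, Or.inl ?_⟩
    ext k
    rw [pos_eq_ofInt, ofInt_apply, hv, h]
  · refine ⟨i, Or.inr ?_⟩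
    ext k
    rw [PiLp.neg_apply, pos_eq_ofInt, ofInt_apply, hv, h]
    simp
    ring

/-- Every root is positive or negative. -/
theorem eq_pos_or_eq_neg_pos (r : Φ) : ∃ i, r = pos i ∨ r = -pos i := by
  suffices h : ∀ v ∈ Φ, ∃ i, v = (pos i : V) ∨ v = -(pos i : V) by
    obtain ⟨i, h | h⟩ := h r r.2
    · exact ⟨i, Or.inl (Subtype.ext h)⟩
    · exact ⟨i, Or.inr (Subtype.ext h)⟩
  have hneg : ∀ v : V, (∃ i, v = (pos i : V) ∨ v = -(pos i : V)) →
      ∃ i, -v = (pos i : V) ∨ -v = -(pos i : V) := by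
    rintro v ⟨i, rfl | rfl⟩
    · exact ⟨i, Or.inr rfl⟩
    · exact ⟨i, Or.inl (neg_neg _)⟩
  have he : ∀ i, ∃ j, e i = (pos j : V) ∨ e i = -(pos j : V) := fun i =>
    eq_pos_or_eq_neg_pos_of_doubled (w := fun k => if k = i then 2 else 0)
      (fun k => by simp [e, ite_div])
      (by revert i; decide +kernel)
  have hadd : ∀ i j, i ≠ j → ∃ l, e i + e j = (pos l : V) ∨ e i + e j = -(pos l : V) :=
    fun i j hij => eq_pos_or_eq_neg_pos_of_doubled
      (w := fun k => (if k = i then 2 else 0) + if k = j then 2 else 0)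
      (fun k => by simp [e, add_div, ite_div])
      (by revert i j; decide +kernel)
  have hsub : ∀ i j, i ≠ j → ∃ l, e i - e j = (pos l : V) ∨ e i - e j = -(pos l : V) :=
    fun i j hij => eq_pos_or_eq_neg_pos_of_doubled
      (w := fun k => (if k = i then 2 else 0) - if k = j then 2 else 0)
      (fun k => by simp [e, sub_div, ite_div])
      (by revert i j; decide +kernel)
  rintro v ((⟨i, rfl | rfl⟩ | ⟨i, j, hij, rfl | rfl | rfl⟩) | ⟨σ, hσ, rfl⟩)
  · exact he i
  · exact hneg _ (he i)
  · exact hadd i j hij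
  · exact hsub i j hij
  · rw [← neg_add']
    exact hneg _ (hadd i j hij)
  -- Encoding the real signs by booleans reduces the half-integral roots to 16 decidable cases.
  · have hτ : ∀ i, ∃ b : Bool, σ i = ((if b then 1 else -1 : ℤ) : ℝ) := fun i => by
      rcases hσ i with h | h
      · exact ⟨true, by simp [h]⟩
      · exact ⟨false, by simp [h]⟩
    choose τ hτ using hτ
    refine eq_pos_or_eq_neg_pos_of_doubled (w := fun k => if τ k then 1 else -1) (fun k => ?_) ?_
    · rw [← hτ k]
      fin_cases k <;> simp [e, Fin.sum_univ_four] <;> ring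
    · clear hτ
      revert τ
      decide +kernel

theorem prec_ofInt {c d : Fin 4 → ℤ} (h : ∃ i, 0 < (d - c) i ∧ ∀ j < i, (d - c) j = 0) :
    Prec (ofInt c) (ofInt d) := by
  obtain ⟨i, hi, hj⟩ := h
  refine ⟨fun k => ((d - c) k : ℝ), ?_, i, Int.cast_pos.mpr hi, fun j hji => ?_⟩
  · rw [← ofInt_sub]; rfl
  · exact Int.cast_eq_zero.mpr (hj j hji)

theorem prec_pos {i j : Fin 24} (h : i < j) : Prec (pos i : V) (pos j) := by
  apply prec_ofInt
  revert i j
  decide +kernel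

theorem prec_zero_pos (i : Fin 24) : Prec 0 (pos i : V) := by
  have h0 : ofInt 0 = 0 := by simpa using ofInt_sub 0 0
  rw [← h0, pos_eq_ofInt]
  apply prec_ofInt
  revert i
  decide +kernel

/-- Coefficientwise comparison is cruder than the order but suffices to exclude negative roots above
zero or above a positive root. -/
theorem not_prec_ofInt {c d : Fin 4 → ℤ} (h : ∀ k, d k ≤ c k) : ¬ Prec (ofInt c) (ofInt d) := by
  rintro ⟨t, ht, i, hi, -⟩
  rw [← ofInt_sub] at ht
  rw [← congrFun (ofCoeffs_injective ht) i, Pi.sub_apply] at hi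
  have : 0 < d i - c i := by exact_mod_cast hi
  linarith [h i]

theorem coeffs_nonneg : ∀ i k, 0 ≤ coeffs i k := by decide +kernel

theorem eq_pos_of_prec_zero {r : Φ} (h : Prec 0 (r : V)) : ∃ i, r = pos i := by
  obtain ⟨i, rfl | rfl⟩ := eq_pos_or_eq_neg_pos r
  · exact ⟨i, rfl⟩
  · have h0 : ofInt 0 = 0 := by simpa using ofInt_sub 0 0
    rw [coe_neg, pos_eq_ofInt, ← ofInt_neg, ← h0] at h
    exact absurd h (not_prec_ofInt fun k => by simpa using coeffs_nonneg i k)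

theorem eq_pos_of_prec_pos {i : Fin 24} {r : Φ} (h : Prec (pos i) (r : V)) : ∃ j, r = pos j := by
  obtain ⟨j, rfl | rfl⟩ := eq_pos_or_eq_neg_pos r
  · exact ⟨j, rfl⟩
  · rw [coe_neg, pos_eq_ofInt, pos_eq_ofInt, ← ofInt_neg] at h
    refine absurd h (not_prec_ofInt fun k => ?_)
    have := coeffs_nonneg i k
    have := coeffs_nonneg j k
    simp only [Pi.neg_apply]
    linarith

theorem pos_add_pos_of_sumIndex {i j k : Fin 24} (h : sumIndex i j = some k) :
    (pos i : V) + pos j = pos k := by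
  rw [pos_eq_ofInt, pos_eq_ofInt, pos_eq_ofInt, ← ofInt_add, coeffs_of_sumIndex h]

theorem pos_add_pos_ne_zero (i j : Fin 24) : (pos i : V) + pos j ≠ 0 := by
  have h0 : ofInt 0 = 0 := by simpa using ofInt_sub 0 0
  rw [pos_eq_ofInt, pos_eq_ofInt, ← ofInt_add, ← h0, ofInt_injective.ne_iff]
  revert i j
  decide +kernel

/-- Minimality is checked against all decompositions into two positive roots, ordered or not. The
last clause matches the table with `p + 1`: the entry is 2 when the difference is a root, and 1 when
its length rules that out. -/
theorem extraspecialPairs_spec : ∀ p ∈ extraspecialPairs, p.1 < p.2 ∧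
    (sumIndex p.1 p.2).isSome = true ∧
    (∀ k l, coeffs k + coeffs l = coeffs p.1 + coeffs p.2 → p.1 ≤ k) ∧
    (tablePos p.1 p.2 = 1 ∧ quad (coeffs p.2 - coeffs p.1) ≠ 4 ∧
        quad (coeffs p.2 - coeffs p.1) ≠ 8 ∨
      tablePos p.1 p.2 = 2 ∧ ∃ k, coeffs p.2 - coeffs p.1 = coeffs k) := by
  decide +kernel

theorem isExtraspecial_of_mem {p : Fin 24 × Fin 24} (hp : p ∈ extraspecialPairs) :
    IsExtraspecial (pos p.1) (pos p.2) := by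
  obtain ⟨hlt, hs, hmin, -⟩ := extraspecialPairs_spec p hp
  obtain ⟨m, hm⟩ := Option.isSome_iff_exists.mp hs
  refine ⟨⟨pos_add_pos_of_sumIndex hm ▸ (pos m).2, prec_zero_pos _, prec_pos hlt⟩, ?_⟩
  rintro r s ⟨-, h0, hrs⟩ h
  obtain ⟨k, rfl⟩ := eq_pos_of_prec_zero h0
  obtain ⟨l, rfl⟩ := eq_pos_of_prec_pos hrs
  simp only [pos_eq_ofInt, ← ofInt_add] at h
  rcases (hmin k l (ofInt_injective h)).eq_or_lt with h1 | h1
  · exact Or.inl (by rw [h1])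
  · exact Or.inr (prec_pos h1)

theorem quad_of_tableNeg_eq_zero : ∀ i j, i < j → tableNeg i j = 0 →
    quad (coeffs i - coeffs j) ≠ 4 ∧ quad (coeffs i - coeffs j) ≠ 8 := by
  decide +kernel

/-- This is the rotation relation for `r_k + r_i = r_j`, with denominators cleared. -/
theorem tableNeg_spec : ∀ i j, i < j → tableNeg i j ≠ 0 → ∃ k, sumIndex k i = some j ∧
    tableNeg i j * quad (coeffs j) = tablePos k i * quad (coeffs k) := by
  decide +kernel

variable {L : Type*} [LieRing L] [LieAlgebra ℂ L] [FiniteDimensional ℂ L]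
  [LieAlgebra.IsSimple ℂ L] {H : LieSubalgebra ℂ L} [H.IsCartanSubalgebra]
  {f : RootIdentification H}

/-! ### Structure constants of a Chevalley basis against the tables -/

namespace ChevalleyBasis

theorem jacobiTerm_eq (B : ChevalleyBasis f) (i j k : Fin 24) :
    jacobiTerm (fun i j => B.N (pos i) (pos j)) i j k =
      B.const (pos j) (pos k) * B.const (pos i) (pos j + pos k) := by
  unfold jacobiTerm
  cases h : sumIndex j k with
  | none =>
    have hT : tablePos j k = 0 := by simpa [h] using sumIndex_isSome_iff j k
    rw [B.const_eq_zero (v := pos j) (w := pos k), zero_mul, Option.elim_none]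
    rw [pos_eq_ofInt, pos_eq_ofInt, ← ofInt_add]
    exact ofInt_notMem (quad_of_tablePos_eq_zero j k hT)
  | some m =>
    rw [pos_add_pos_of_sumIndex h, Option.elim_some, B.const_coe, B.const_coe]

theorem N_pos_pos (B : ChevalleyBasis f) (hB : ∀ r s : Φ, IsExtraspecial r s → 0 < B.N r s)
    (i j : Fin 24) : B.N (pos i) (pos j) = tablePos i j := by
  refine eq_tablePos (M := fun i j => B.N (pos i) (pos j)) (fun i j => B.N_swap _ _)
    (fun i j h => ?_) (fun i j k => ?_) (fun p hp => ?_) i j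
  · apply B.N_eq_zero
    rw [pos_eq_ofInt, pos_eq_ofInt, ← ofInt_add]
    exact ofInt_notMem (quad_of_tablePos_eq_zero i j h)
  · rw [jacobiTerm_eq, jacobiTerm_eq, jacobiTerm_eq]
    exact B.const_jacobi (pos_add_pos_ne_zero _ _) (pos_add_pos_ne_zero _ _)
      (pos_add_pos_ne_zero _ _)
  -- The root string gives the constant up to sign, and the extraspecial hypothesis selects the
  -- positive sign.
  · have hpos := hB _ _ (isExtraspecial_of_mem hp)
    obtain ⟨-, hs, -, ⟨hT, hq⟩ | ⟨hT, k, hk⟩⟩ := extraspecialPairs_spec p hp <;>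
    obtain ⟨m, hm⟩ := Option.isSome_iff_exists.mp hs <;>
    have hmem : (pos p.1 : V) + pos p.2 ∈ Φ := pos_add_pos_of_sumIndex hm ▸ (pos m).2
    · rcases B.N_eq_of_sub_notMem hmem (by
        rw [pos_eq_ofInt, pos_eq_ofInt, ← ofInt_sub]; exact ofInt_notMem hq) with h | h <;>
      omega
    · rcases B.N_eq_of_sub_mem hmem (by
        rw [pos_eq_ofInt, pos_eq_ofInt, ← ofInt_sub, hk]; exact (pos k).2) with h | h <;>
      omega

theorem N_pos_neg (B : ChevalleyBasis f) (hB : ∀ r s : Φ, IsExtraspecial r s → 0 < B.N r s)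
    {i j : Fin 24} (hij : i < j) : B.N (pos i) (-pos j) = tableNeg i j := by
  by_cases h : tableNeg i j = 0
  · rw [h]
    apply B.N_eq_zero
    rw [coe_neg, ← sub_eq_add_neg, pos_eq_ofInt, pos_eq_ofInt, ← ofInt_sub]
    exact ofInt_notMem (quad_of_tableNeg_eq_zero i j hij h)
  · obtain ⟨k, hk, hq⟩ := tableNeg_spec i j hij h
    have hrot := (B.const_rotate (pos_add_pos_of_sumIndex hk)).1
    have a := inner_self_pos (pos j).2
    have b := inner_self_pos (pos k).2
    rw [div_eq_div_iff a.ne' b.ne', B.N_pos_pos hB] at hrot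
    have hq' : (tableNeg i j : ℝ) * quad (coeffs j) = tablePos k i * quad (coeffs k) := by
      exact_mod_cast hq
    rw [pos_eq_ofInt, pos_eq_ofInt, inner_ofInt, inner_ofInt] at hrot
    rw [pos_eq_ofInt, inner_ofInt] at a
    have : (B.N (pos i) (-pos j) : ℝ) = tableNeg i j := by
      apply mul_right_cancel₀ a.ne'
      linarith
    exact_mod_cast this

end ChevalleyBasis

end F4

open F4 in
theorem theorem2 {L : Type*} [LieRing L] [LieAlgebra ℂ L] [FiniteDimensional ℂ L]
    [LieAlgebra.IsSimple ℂ L] (H : LieSubalgebra ℂ L) [H.IsCartanSubalgebra]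
    (f : RootIdentification H) (B : ChevalleyBasis f)
    (hB : ∀ r s : Φ, IsExtraspecial r s → 0 < B.N r s) :
    (∀ i j : Fin 24, B.N (pos i) (pos j) = tablePos i j) ∧
    (∀ i j : Fin 24, i < j → B.N (pos i) (-pos j) = tableNeg i j) ∧
    (∀ r s : Φ, B.N s r = -B.N r s ∧ B.N (-r) (-s) = -B.N r s) :=
  ⟨B.N_pos_pos hB, fun _ _ => B.N_pos_neg hB, fun r s => ⟨B.N_swap r s, B.N_neg_neg r s⟩⟩
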